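/- Let $n\in\{2,3\}$, $Q=(0,1)^n$, and let $Q_1,Q_2\subset Q$ be disjoint open sets of positive measure with $Q=Q_1\cup Q_2\cup\Gamma$, $\Gamma=\overline{Q_1}\cap\overline{Q_2}$, such that $\overline{Q_2}\subset Q$, $Q_1$ is connected, and $Q_2$ has a $C^1$ boundary and lies locally on one side of it. Let $\mu_1>0$ and $\mu(y;z)=\mu_1\chi_{Q_1}(y)+z\mu_1\chi_{Q_2}(y)$ for $z\in\mathbb{C}$, let $\mathbf e_1,\dots,\mathbf e_n$ be the standard basis of $\mathbb R^n$, and write $e(\mathbf u)=\frac12(\nabla\mathbf u+\nabla^T\mathbf u)$ and $A:B=\sum_{k,l}A_{kl}B_{kl}$. Let $H(Q)$ be the space of $Q$-periodic complex vector fields $\mathbf v\in H^1(Q_1\cup Q_2)^n$ with $\operatorname{div}\mathbf v=0$, with zero jump $[\![\mathbf v]\!]=\mathbf 0$ across $\Gamma$, with $\mathbf v\cdot\mathbf n=0$ in $H^{-1/2}(\Gamma)$, and with $(\mathbf v,\eta)_{H^1(Q_2)}=0$ for every rigid displacement $\eta(y)=Ay+b$ ($A$ skew-symmetric). For $k=1,\dots,n$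 let $\mathbf u^k=\mathbf u^k(\cdot\,;z)\in H(Q)$ be the weak solution of the cell problem, i.e. $$\int_{Q_1\cup Q_2}2\mu(y;z)\,e(\mathbf u^k):\overline{e(\mathbf v)}\,dy=\int_{Q_1\cup Q_2}\mathbf e_k\cdot\overline{\mathbf v}\,dy\qquad\text{for all }\mathbf v\in H(Q),$$ and let the self-permeability be the $n\times n$ matrix $K(z)$ with entries $K_{ij}(z)=\int_Q\mathbf u^j(y;z)\cdot\mathbf e_i\,dy$. **Proposition.** For every $z\in\mathbb C\setminus(-\infty,0]$ and every $k$ the weak solution $\mathbf u^k(\cdot\,;z)$ exists and is unique, so that $K(z)$ is well defined, and $$K_{ij}(z)=\int_Q2\mu(y;\bar z)\,\overline{e(\mathbf u^i)}:e(\mathbf u^j)\,dy,\qquad i,j=1,\dots,n.$$ Moreover, with $K^*$ the conjugate transpose of $K$ and with $\le$ the order of Hermitian matrices ($A\le B$ if and only if $B-A$ is Hermitian positive semidefinite), $$\frac{K(z)-K^*(z)}{z-\bar z}\le0\quad\text{if }\operatorname{Im}z\neq0,\qquad\qquad K(x)\ge0\quad\text{for real }x>0.$$ -/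

import Mathlib

open MeasureTheory Topology
open scoped ContDiff ComplexOrder MatrixOrder Matrix ComplexConjugate

/-- The open unit cell `Q = (0,1)ⁿ`. -/
def unitCell (n : ℕ) : Set (Fin n → ℝ) := Set.univ.pi fun _ => Set.Ioo (0 : ℝ) 1

/-- `S` (an open set) has a `C¹` boundary and lies locally on one side of it: near each boundary
point, `S` is the sublevel set `{f < 0}` of a `C¹` function `f` with non-vanishing derivative. -/
def HasC1Boundary {n : ℕ} (S : Set (Fin n → ℝ)) : Prop :=
  ∀ p ∈ frontier S, ∃ f : (Fin n → ℝ) → ℝ,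
    ContDiffAt ℝ 1 f p ∧ fderiv ℝ f p ≠ 0 ∧ ∀ᶠ y in 𝓝 p, (y ∈ S ↔ f y < 0)

/-- A periodic cell `Q` made of a host phase `Q₁`, an inclusion `Q₂` and the interface
`Γ = cl Q₁ ∩ cl Q₂`.  As `cl Q₂ ⊆ Q`, the `Q`-periodic extensions of both phases have boundary
`⋃ₖ (∂Q₂ + k)`, so that the regularity of these is the regularity of `∂Q₂`. -/
structure PeriodicCell (n : ℕ) where
  Q₁ : Set (Fin n → ℝ)
  Q₂ : Set (Fin n → ℝ)
  isOpen₁ : IsOpen Q₁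
  isOpen₂ : IsOpen Q₂
  disjoint : Disjoint Q₁ Q₂
  cover : Q₁ ∪ Q₂ ∪ (closure Q₁ ∩ closure Q₂) = unitCell n
  closure_subset : closure Q₂ ⊆ unitCell n
  volume_pos₁ : 0 < volume Q₁
  volume_pos₂ : 0 < volume Q₂
  connected₁ : IsConnected Q₁
  c1Boundary : HasC1Boundary Q₂

/-- The partial derivative `∂φ/∂yⱼ` of a smooth function. -/
noncomputable def partialD {n : ℕ} (j : Fin n) (φ : (Fin n → ℝ) → ℂ) (y : Fin n → ℝ) : ℂ :=
  fderiv ℝ φ y (Pi.single j 1)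

namespace PeriodicCell

variable {n : ℕ} (C : PeriodicCell n)

/-- `Q₁ ∪ Q₂`, which is `Q` up to the null set `Γ`. -/
def phases : Set (Fin n → ℝ) := C.Q₁ ∪ C.Q₂

/-- The complex space `L²(Q₁ ∪ Q₂)`. -/
abbrev L2 : Type := Lp ℂ 2 (volume.restrict C.phases)

/-- Pairs `(v, G)` of a vector field `v ∈ L²(Q₁ ∪ Q₂)ⁿ` and a matrix field
`G ∈ L²(Q₁ ∪ Q₂)ⁿˣⁿ`, a Hilbert space.  A velocity field in `H¹` is represented by the pair
`(v, ∇v)`, and the norm is then the `H¹` norm. -/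
abbrev VelGrad : Type := PiLp 2 fun _ : Fin n ⊕ Fin n × Fin n => C.L2

variable {C}

/-- The component `vᵢ`. -/
def vel (u : C.VelGrad) (i : Fin n) : C.L2 := u (Sum.inl i)

/-- The component `Gᵢⱼ = ∂vᵢ/∂yⱼ`. -/
def grad (u : C.VelGrad) (i j : Fin n) : C.L2 := u (Sum.inr (i, j))

/-- The entry `(i, j)` of the symmetric gradient `e(v) = (∇v + ∇ᵀv) / 2`. -/
noncomputable def strain (u : C.VelGrad) (i j : Fin n) (y : Fin n → ℝ) : ℂ :=
  (grad u i j y + grad u j i y) / 2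

/-- The integration by parts formula, without boundary terms, against the function `φ`. -/
def PartsFormula (u : C.VelGrad) (φ : (Fin n → ℝ) → ℂ) : Prop :=
  ∀ i j, ∫ y in C.phases, vel u i y * partialD j φ y = - ∫ y in C.phases, grad u i j y * φ y

/-- `v ∈ H¹(Q₁ ∪ Q₂)ⁿ` with weak gradient `G`. -/
def IsWeakGrad (u : C.VelGrad) : Prop :=
  ∀ φ : (Fin n → ℝ) → ℂ, ContDiff ℝ ∞ φ → HasCompactSupport φ → tsupport φ ⊆ C.phases →
    PartsFormula u φ

/-- `⟦v⟧ = 0` on `Γ`: test functions that do not vanish on `Γ` produce no interface term. -/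
def NoJump (u : C.VelGrad) : Prop :=
  ∀ φ : (Fin n → ℝ) → ℂ, ContDiff ℝ ∞ φ → HasCompactSupport φ → tsupport φ ⊆ unitCell n →
    PartsFormula u φ

/-- `v` is `Q`-periodic, i.e. has equal traces on opposite faces of `Q`: against `Q`-periodic
smooth functions the contributions of opposite faces cancel. -/
def IsCellPeriodic (u : C.VelGrad) : Prop :=
  ∀ φ : (Fin n → ℝ) → ℂ, ContDiff ℝ ∞ φ →
    (∀ (y : Fin n → ℝ) (k : Fin n → ℤ), φ (y + fun i => (k i : ℝ)) = φ y) → PartsFormula u φ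

/-- `div v = 0` (almost everywhere in `Q₁ ∪ Q₂`). -/
def DivFree (u : C.VelGrad) : Prop := ∑ i, grad u i i = 0

/-- `v · n = 0` in `H^{-1/2}(Γ)`, `Γ = ∂Q₂`: the normal trace, which is the functional
`φ ↦ ∫_{Q₂} (v · ∇φ + φ div v)`, vanishes. -/
def NoNormalTrace (u : C.VelGrad) : Prop :=
  ∀ φ : (Fin n → ℝ) → ℂ, ContDiff ℝ ∞ φ →
    ∫ y in C.Q₂, ((∑ i, vel u i y * partialD i φ y) + φ y * ∑ i, grad u i i y) = 0

/-- `(v, η)_{H¹(Q₂)} = 0` for every rigid displacement `η(y) = A y + b`, `A` skew-symmetric. -/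
def RigidOrthogonal (u : C.VelGrad) : Prop :=
  ∀ (A : Matrix (Fin n) (Fin n) ℝ) (b : Fin n → ℝ), Aᵀ = -A →
    ∫ y in C.Q₂, ((∑ i, vel u i y * (((A *ᵥ y) i + b i : ℝ) : ℂ))
      + ∑ i, ∑ j, grad u i j y * ((A i j : ℝ) : ℂ)) = 0

variable (C)

/-- The space `H(Q)` of admissible velocity fields. -/
def admissible : Set C.VelGrad :=
  {u | IsWeakGrad u ∧ NoJump u ∧ IsCellPeriodic u ∧ DivFree u ∧ NoNormalTrace u ∧
    RigidOrthogonal u}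

/-- The viscosity `μ(y; z) = μ₁ χ₁(y) + z μ₁ χ₂(y)`. -/
noncomputable def viscosity (μ₁ : ℝ) (z : ℂ) (y : Fin n → ℝ) : ℂ :=
  μ₁ * C.Q₁.indicator 1 y + z * μ₁ * C.Q₂.indicator 1 y

/-- `∫ 2 μ(y; z) e(u) : conj e(v) dy`. -/
noncomputable def viscousForm (μ₁ : ℝ) (z : ℂ) (u v : C.VelGrad) : ℂ :=
  ∫ y in C.phases,
    2 * C.viscosity μ₁ z y * ∑ i, ∑ j, strain u i j y * conj (strain v i j y)

/-- `u` is a weak solution, in `H(Q)`, of the cell problem with unit force `eₖ`. -/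
def IsCellSolution (μ₁ : ℝ) (z : ℂ) (k : Fin n) (u : C.VelGrad) : Prop :=
  u ∈ C.admissible ∧
    ∀ v ∈ C.admissible, C.viscousForm μ₁ z u v = ∫ y in C.phases, conj (vel v k y)

open Classical in
/-- The solution `uᵏ(·; z)` of the cell problem (zero where there is none). -/
noncomputable def cellSolution (μ₁ : ℝ) (z : ℂ) (k : Fin n) : C.VelGrad :=
  if h : ∃ u, C.IsCellSolution μ₁ z k u then h.choose else 0

/-- The self-permeability `K(z)`, `Kᵢⱼ(z) = ∫_Q uʲ(y; z) · eᵢ dy`. -/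
noncomputable def selfPermeability (μ₁ : ℝ) (z : ℂ) : Matrix (Fin n) (Fin n) ℂ :=
  Matrix.of fun i j => ∫ y in C.phases, vel (C.cellSolution μ₁ z j) i y

end PeriodicCell

/-! Let `S₁`, `S₂` be the symmetric gradient restricted to the two phases. Then the viscous form is
`2μ₁(⟪S₁ v, S₁ u⟫ + z ⟪S₂ v, S₂ u⟫)`. Off the negative half-line, 1 and `z` lie in a common open
half-plane through the origin, so after multiplication by a suitable constant the real part of the
form dominates `‖S₁ u‖² + ‖S₂ u‖²`. Well-posedness therefore reduces to coercivity of the strain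
energy on the closed subspace of admissible fields (`exists_coercive`).

Coercivity is proved with Fourier series. Testing periodicity against exponentials turns the
gradient, extended by zero across the interface, into multiplication by frequencies. Korn's
inequality is then an algebraic inequality for each mode, and Poincaré–Wirtinger follows because
nonzero frequencies are bounded below. The remaining mean value is controlled by orthogonality to
constants on the inclusion, which has positive measure.

Testing the equation for `uⁱ` with `uʲ` and conjugating gives `K(z) = 2μ₁(A + z̄ B)`, where `A`, `B`
are the Gram matrices of the strains on the two phases (`selfPermeability_eq_gram`). Gram matrices
are positive semidefinite. Hence `(K - K*)/(z - z̄) = -2μ₁ B ≤ 0`, and `K(x) ≥ 0` for `x > 0`. -/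

/-! ### Complex Lax–Milgram for a two-phase form -/

/-- A complex Lax–Milgram lemma: if `S₁ ⊕ S₂` is bounded below and `z` is off the negative real
half-line, then the form `⟪S₁ v, S₁ u⟫ + z ⟪S₂ v, S₂ u⟫` represents every vector uniquely. -/
theorem existsUnique_inner_add_mul_inner {H F₁ F₂ : Type*}
    [NormedAddCommGroup H] [InnerProductSpace ℂ H] [CompleteSpace H]
    [NormedAddCommGroup F₁] [InnerProductSpace ℂ F₁] [CompleteSpace F₁]
    [NormedAddCommGroup F₂] [InnerProductSpace ℂ F₂] [CompleteSpace F₂]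
    (S₁ : H →L[ℂ] F₁) (S₂ : H →L[ℂ] F₂) {c : ℝ} (hc : 0 < c)
    (hS : ∀ u, c * ‖u‖ ^ 2 ≤ ‖S₁ u‖ ^ 2 + ‖S₂ u‖ ^ 2)
    {z : ℂ} (hz : z ∈ Complex.slitPlane) (f : H) :
    ∃! u : H, ∀ v : H, inner ℂ (S₁ v) (S₁ u) + z * inner ℂ (S₂ v) (S₂ u) = inner ℂ v f := by
  set T : H →L[ℂ] H := S₁.adjoint ∘L S₁ + z • (S₂.adjoint ∘L S₂) with hT
  have hTi : ∀ u v, inner ℂ v (T u) = inner ℂ (S₁ v) (S₁ u) + z * inner ℂ (S₂ v) (S₂ u) := by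
    intro u v
    simp [hT, ContinuousLinearMap.adjoint_inner_right]
  have hz0 : 0 < ‖z‖ := norm_pos_iff.2 (Complex.slitPlane_ne_zero hz)
  have hpos : 0 < ‖z‖ + z.re := by
    rcases hz with h | h
    · positivity
    · have h1 : |z.re| < ‖z‖ := Complex.abs_re_lt_norm.2 h
      have h2 := neg_abs_le z.re
      linarith
  -- Multiplication by `w` rotates by minus half the argument of `z`, which places both 1 and `z` in
  -- the open right half-plane: `w` and `w * z` have positive real parts, and `m` is the smaller of
  -- the two.
  set w : ℂ := ‖z‖ + conj z with hw
  have hwre : w.re = ‖z‖ + z.re := by simp [hw]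
  have hwz : (w * z).re = ‖z‖ * (‖z‖ + z.re) := by
    have h1 : conj z * z = ((‖z‖ ^ 2 : ℝ) : ℂ) := by
      rw [mul_comm, Complex.mul_conj, Complex.normSq_eq_norm_sq]
    rw [hw, add_mul, h1, Complex.add_re, Complex.ofReal_re, Complex.re_ofReal_mul]
    ring
  set m : ℝ := min (‖z‖ + z.re) (‖z‖ * (‖z‖ + z.re)) with hm
  have hm0 : 0 < m := lt_min hpos (mul_pos hz0 hpos)
  have hcoer : ∀ u, m * c * ‖u‖ ^ 2 ≤ ‖w‖ * ‖inner ℂ u (T u)‖ := by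
    intro u
    have h1 : (w * inner ℂ u (T u)).re
        = (‖z‖ + z.re) * ‖S₁ u‖ ^ 2 + ‖z‖ * (‖z‖ + z.re) * ‖S₂ u‖ ^ 2 := by
      rw [hTi, inner_self_eq_norm_sq_to_K, inner_self_eq_norm_sq_to_K, mul_add, ← mul_assoc,
        ← hwz, ← hwre]
      norm_cast
      simp only [Complex.coe_algebraMap, Complex.add_re, Complex.re_mul_ofReal]
    have h2 : (w * inner ℂ u (T u)).re ≤ ‖w‖ * ‖inner ℂ u (T u)‖ := by
      rw [← norm_mul]; exact Complex.re_le_norm _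
    have h3 := min_le_left (‖z‖ + z.re) (‖z‖ * (‖z‖ + z.re))
    have h4 := min_le_right (‖z‖ + z.re) (‖z‖ * (‖z‖ + z.re))
    rw [← hm] at h3 h4
    calc m * c * ‖u‖ ^ 2 = m * (c * ‖u‖ ^ 2) := by ring
      _ ≤ m * (‖S₁ u‖ ^ 2 + ‖S₂ u‖ ^ 2) := by gcongr; exact hS u
      _ = m * ‖S₁ u‖ ^ 2 + m * ‖S₂ u‖ ^ 2 := by ring
      _ ≤ _ := by rw [h1] at h2; refine le_trans ?_ h2; gcongr
  have hw0 : 0 < ‖w‖ := norm_pos_iff.2 fun h => by rw [h] at hwre; simp at hwre; linarith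
  have hbelow : ∀ u, ‖u‖ ≤ (‖w‖ / (m * c)) * ‖T u‖ := by
    intro u
    rcases eq_or_ne u 0 with rfl | hu
    · simp
    have hu0 : 0 < ‖u‖ := norm_pos_iff.2 hu
    have h1 := (hcoer u).trans (mul_le_mul_of_nonneg_left (norm_inner_le_norm u (T u)) hw0.le)
    have h2 : m * c * ‖u‖ ≤ ‖w‖ * ‖T u‖ := by
      refine le_of_mul_le_mul_right ?_ hu0
      linarith
    rw [div_mul_eq_mul_div, le_div_iff₀ (by positivity)]
    linarith
  have hanti : AntilipschitzWith (‖w‖ / (m * c)).toNNReal T :=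
    ContinuousLinearMap.antilipschitz_of_bound T fun u => by
      rw [Real.coe_toNNReal _ (by positivity)]; exact hbelow u
  have hclosed : IsClosed (T.range : Set H) := hanti.isClosed_range T.uniformContinuous
  -- The range is closed, so it suffices that its orthogonal complement vanishes: if `u` is
  -- orthogonal to `T u`, coercivity forces `u = 0`.
  have hsurj : T.range = ⊤ := by
    have := hclosed.completeSpace_coe
    rw [← T.range.orthogonal_orthogonal, Submodule.eq_top_iff']
    intro v u hu
    have h0 : inner ℂ u (T u) = 0 := inner_eq_zero_symm.1 (hu _ ⟨u, rfl⟩)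
    have h1 := hcoer u
    rw [h0, norm_zero, mul_zero] at h1
    have h2 : ‖u‖ ^ 2 = 0 := by
      refine le_antisymm ?_ (by positivity)
      exact le_of_mul_le_mul_left (by simpa using h1) (mul_pos hm0 hc)
    have : u = 0 := by simpa using h2
    simp [this]
  obtain ⟨u, hu⟩ : f ∈ T.range := hsurj ▸ Submodule.mem_top
  refine ⟨u, fun v => ?_, fun u' hu' => ?_⟩
  · rw [← hTi]; exact congrArg _ hu
  · refine hanti.injective (ext_inner_left ℂ fun v => ?_)
    rw [hTi, hu' v]; exact (congrArg _ hu).symm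

/-! ### Fourier series on the unit cube -/

section Parseval

-- Normalized Haar measure, for which the exponentials on the torus are orthonormal.
noncomputable local instance : MeasureSpace UnitAddCircle := ⟨AddCircle.haarAddCircle⟩

/-- The exponential `y ↦ exp (-2πi k · y)`. -/
noncomputable def cellExp {d : Type*} [Fintype d] (k : d → ℤ) (y : d → ℝ) : ℂ :=
  UnitAddTorus.mFourier (-k) fun i => (y i : UnitAddCircle)

theorem cellExp_eq {d : Type*} [Fintype d] (k : d → ℤ) (y : d → ℝ) :
    cellExp k y = Complex.exp (∑ i, -(2 * Real.pi * Complex.I * k i) * y i) := by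
  rw [cellExp, UnitAddTorus.mFourier, Complex.exp_sum]
  refine Finset.prod_congr rfl fun i _ => ?_
  rw [fourier_coe_apply]
  congr 1
  simp

theorem cellExp_zero {d : Type*} [Fintype d] (y : d → ℝ) : cellExp (0 : d → ℤ) y = 1 := by
  simp [cellExp_eq]

/-- The half-open unit cube. -/
def halfOpenCube (d : Type*) : Set (d → ℝ) := {x | ∀ i, x i ∈ Set.Ioc (0 : ℝ) 1}

theorem measurableSet_halfOpenCube (d : Type*) [Finite d] : MeasurableSet (halfOpenCube d) :=
  MeasurableSet.univ_pi' fun _ => measurableSet_Ioc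

/-- Parseval's identity on the unit cube. -/
theorem hasSum_sq_integral_mul_cellExp {d : Type*} [Fintype d] {f : (d → ℝ) → ℂ}
    (hf : MemLp f 2 (volume.restrict (halfOpenCube d))) :
    HasSum (fun k : d → ℤ => ‖∫ y in halfOpenCube d, f y * cellExp k y‖ ^ 2)
      (∫ y in halfOpenCube d, ‖f y‖ ^ 2) := by
  have hset : {x : d → ℝ | ∀ i, x i ∈ Set.Ioc ((0 : d → ℝ) i) ((0 : d → ℝ) i + 1)}
      = halfOpenCube d := by simp [halfOpenCube]
  set e := UnitAddTorus.measurableEquivPiIoc (0 : d → ℝ) with he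
  set F : UnitAddTorus d → ℂ := fun t => f (e t).1 with hF
  have hFx : ∀ x ∈ halfOpenCube d, F (fun i => (x i : UnitAddCircle)) = f x := by
    intro x hx
    rw [← hset] at hx
    have : e (e.symm ⟨x, hx⟩) = ⟨x, hx⟩ := e.apply_symm_apply _
    exact congrArg (fun p => f p.1) this
  have hFmem : MemLp F 2 volume := by
    refine MemLp.comp_measurePreserving (g := fun p => f p.1) ?_
      (UnitAddTorus.measurePreserving_equivPiIoc (0 : d → ℝ))
    rw [← hset, ← map_comap_subtype_coe (hset ▸ measurableSet_halfOpenCube d)] at hf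
    exact hf.comp_of_map measurable_subtype_coe.aemeasurable
  have key := UnitAddTorus.hasSum_sq_mFourierCoeff (hFmem.toLp F)
  have h1 : ∫ t, ‖(hFmem.toLp F) t‖ ^ 2 = ∫ y in halfOpenCube d, ‖f y‖ ^ 2 := by
    rw [← hset]
    rw [integral_congr_ae (g := fun t => ‖F t‖ ^ 2)
      (hFmem.coeFn_toLp.mono fun t ht => by simp only [ht]),
      UnitAddTorus.integral_preimage _ 0, hset]
    exact setIntegral_congr_fun (measurableSet_halfOpenCube d) fun x hx => by simp only [hFx x hx]
  have h2 : ∀ k, UnitAddTorus.mFourierCoeff (hFmem.toLp F) k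
      = ∫ y in halfOpenCube d, f y * cellExp k y := by
    intro k
    have : UnitAddTorus.mFourierCoeff (hFmem.toLp F) k = UnitAddTorus.mFourierCoeff F k :=
      integral_congr_ae (hFmem.coeFn_toLp.mono fun t ht => by simp only [ht])
    rw [this, UnitAddTorus.mFourierCoeff_eq_integral _ _ 0, hset]
    refine setIntegral_congr_fun (measurableSet_halfOpenCube d) fun x hx => ?_
    simp only [hFx x hx, smul_eq_mul, cellExp, mul_comm]
  rw [h1] at key
  simpa only [h2] using key

end Parseval

theorem contDiff_cellExp {d : Type*} [Fintype d] (k : d → ℤ) : ContDiff ℝ ∞ (cellExp k) := by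
  have : cellExp k = fun y : d → ℝ =>
      Complex.exp (∑ i, -(2 * Real.pi * Complex.I * k i) * Complex.ofRealCLM (y i)) :=
    funext fun y => cellExp_eq k y
  rw [this]
  fun_prop

theorem cellExp_add_int {d : Type*} [Fintype d] (k : d → ℤ) (y : d → ℝ) (m : d → ℤ) :
    cellExp k (y + fun i => (m i : ℝ)) = cellExp k y := by
  unfold cellExp
  congr 1
  funext i
  have : ((m i : ℝ) : UnitAddCircle) = 0 := by
    rw [AddCircle.coe_eq_zero_iff]; exact ⟨m i, by simp⟩
  simp

theorem partialD_cellExp {n : ℕ} (k : Fin n → ℤ) (j : Fin n) (y : Fin n → ℝ) :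
    partialD j (cellExp k) y = -(2 * Real.pi * Complex.I * k j) * cellExp k y := by
  set L : (Fin n → ℝ) →L[ℝ] ℂ :=
    ∑ i, (-(2 * Real.pi * Complex.I * k i) : ℂ) • (Complex.ofRealCLM ∘L ContinuousLinearMap.proj i)
    with hL
  have hLy : ∀ y, L y = ∑ i, -(2 * Real.pi * Complex.I * k i) * (y i : ℂ) := by
    intro y
    simp [hL]
  have : cellExp k = fun y : Fin n → ℝ => Complex.exp (L y) :=
    funext fun y => by rw [cellExp_eq, hLy]
  have hd : HasFDerivAt (cellExp k) (Complex.exp (L y) • L) y := by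
    rw [this]
    exact L.hasFDerivAt.cexp
  rw [partialD, hd.fderiv, this]
  simp only [smul_apply, hLy, smul_eq_mul]
  rw [mul_comm]
  congr 1
  rw [Finset.sum_eq_single j]
  · simp
  · intro i _ hi; simp [hi]
  · simp

/-- A sharp Korn inequality for a single Fourier mode. -/
theorem sum_norm_sq_mode_le {ι : Type*} [Fintype ι] (κ : ι → ℝ) (c : ι → ℂ) :
    ∑ i, ∑ j, ‖κ j * c i‖ ^ 2 ≤ 2 * ∑ i, ∑ j, ‖(κ j * c i + κ i * c j) / 2‖ ^ 2 := by
  have h1 : ∀ i j, ‖(κ j * c i + κ i * c j) / 2‖ ^ 2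
      = (‖κ j * c i‖ ^ 2 + ‖κ i * c j‖ ^ 2
        + 2 * ((κ i * c i) * conj (κ j * c j : ℂ)).re) / 4 := by
    intro i j
    simp only [norm_div, div_pow, ← Complex.normSq_eq_norm_sq, Complex.normSq_add]
    have : (κ j * c i : ℂ) * conj (κ i * c j : ℂ) = (κ i * c i) * conj (κ j * c j : ℂ) := by
      simp only [map_mul, Complex.conj_ofReal]; ring
    rw [this, Complex.normSq_ofNat]
    norm_num
  -- The cross terms add up to the squared modulus of the divergence symbol `κ · c`. It is
  -- nonnegative and can be dropped; equality holds for divergence-free modes.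
  have h2 : ∑ i, ∑ j, ((κ i * c i) * conj (κ j * c j : ℂ)).re = ‖∑ i, κ i * c i‖ ^ 2 := by
    rw [← Complex.normSq_eq_norm_sq, ← Complex.ofReal_re (Complex.normSq _), ← Complex.mul_conj,
      map_sum, Finset.sum_mul_sum, Complex.re_sum]
    exact Finset.sum_congr rfl fun i _ => (Complex.re_sum _ _).symm
  simp only [h1, ← Finset.sum_div, Finset.sum_add_distrib, ← Finset.mul_sum, h2]
  rw [Finset.sum_comm (f := fun i j => ‖(κ i * c j : ℂ)‖ ^ 2)]
  nlinarith [sq_nonneg ‖∑ i, κ i * c i‖]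

/-! ### Closed subspaces cut out by linear conditions -/

/-- The sets of vectors that form a closed linear subspace. -/
def IsClosedSubspace {E : Type*} [NormedAddCommGroup E] [NormedSpace ℂ E] (s : Set E) : Prop :=
  ∃ V : Submodule ℂ E, IsClosed (V : Set E) ∧ (V : Set E) = s

namespace IsClosedSubspace

variable {E F : Type*} [NormedAddCommGroup E] [NormedSpace ℂ E] [NormedAddCommGroup F]
  [NormedSpace ℂ F]

theorem setOf_forall {ι : Sort*} {p : ι → E → Prop} (h : ∀ i, IsClosedSubspace {u | p i u}) :
    IsClosedSubspace {u | ∀ i, p i u} := by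
  choose V hV hVp using h
  refine ⟨⨅ i, V i, ?_, ?_⟩
  · rw [Submodule.coe_iInf]; exact isClosed_iInter hV
  · rw [Submodule.coe_iInf]; ext u; simp [hVp]

theorem setOf_and {p q : E → Prop} (hp : IsClosedSubspace {u | p u})
    (hq : IsClosedSubspace {u | q u}) : IsClosedSubspace {u | p u ∧ q u} := by
  obtain ⟨V, hV, hVp⟩ := hp
  obtain ⟨W, hW, hWq⟩ := hq
  exact ⟨V ⊓ W, hV.inter hW, by rw [Submodule.coe_inf, hVp, hWq]; rfl⟩

theorem of_iff {p : E → Prop} (L : E →L[ℂ] F) (h : ∀ u, p u ↔ L u = 0) :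
    IsClosedSubspace {u | p u} :=
  ⟨L.ker, L.isClosed_ker, by ext u; simp [h]⟩

end IsClosedSubspace

theorem unitCell_subset_halfOpenCube (n : ℕ) : unitCell n ⊆ halfOpenCube (Fin n) :=
  fun _ hx i => Set.Ioo_subset_Ioc_self (hx i trivial)

theorem volume_unitCell (n : ℕ) : volume (unitCell n) = 1 := by
  simp [unitCell, Real.volume_pi_Ioo]

theorem continuous_partialD {n : ℕ} (j : Fin n) {φ : (Fin n → ℝ) → ℂ} (hφ : ContDiff ℝ ∞ φ) :
    Continuous (partialD j φ) :=
  (hφ.continuous_fderiv (by simp)).clm_apply continuous_const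

/-! ### The admissible fields as a closed subspace -/

namespace PeriodicCell

variable {n : ℕ} {C : PeriodicCell n}

theorem isOpen_phases : IsOpen C.phases := C.isOpen₁.union C.isOpen₂

theorem measurableSet_phases : MeasurableSet C.phases := isOpen_phases.measurableSet

theorem Q₁_subset_phases : C.Q₁ ⊆ C.phases := Set.subset_union_left

theorem Q₂_subset_phases : C.Q₂ ⊆ C.phases := Set.subset_union_right

theorem phases_subset_unitCell : C.phases ⊆ unitCell n :=
  Set.subset_union_left.trans C.cover.subset

theorem volume_phases_le_one : volume C.phases ≤ 1 :=
  (measure_mono phases_subset_unitCell).trans (volume_unitCell n).le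

instance : IsFiniteMeasure (volume.restrict C.phases) :=
  ⟨by rw [Measure.restrict_apply_univ]; exact volume_phases_le_one.trans_lt ENNReal.one_lt_top⟩

theorem restrict_phases_restrict {s : Set (Fin n → ℝ)} (hs : s ⊆ C.phases) :
    (volume.restrict C.phases).restrict s = volume.restrict s :=
  Measure.restrict_restrict_of_subset hs

/-- Integration against a continuous function over a part of the phases is a continuous linear
functional on `L²`. -/
theorem exists_integral_mul_functional {s : Set (Fin n → ℝ)} (hs : MeasurableSet s)
    (hsC : s ⊆ C.phases) {ψ : (Fin n → ℝ) → ℂ} (hψ : Continuous ψ) :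
    ∃ L : C.L2 →L[ℂ] ℂ, ∀ f : C.L2,
      IntegrableOn (fun y => f y * ψ y) s ∧ L f = ∫ y in s, f y * ψ y := by
  obtain ⟨B, hB⟩ := (isCompact_univ_pi fun _ : Fin n => isCompact_Icc (a := (0 : ℝ)) (b := 1)
    ).exists_bound_of_continuousOn hψ.continuousOn
  -- The functional is the inner product with `conj ψ` cut off to `s`; the conjugate compensates for
  -- conjugate linearity in the first slot. Continuity bounds `ψ` on the compact cube containing the
  -- phases.
  have hmem : MemLp (s.indicator fun y => conj (ψ y)) 2 (volume.restrict C.phases) := by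
    refine MemLp.of_bound ((Complex.continuous_conj.comp hψ).aestronglyMeasurable.indicator hs)
      B ?_
    filter_upwards [ae_restrict_mem measurableSet_phases] with y hy
    refine (norm_indicator_le_norm_self _ _).trans ?_
    rw [RCLike.norm_conj]
    exact hB y fun i hi => Set.Ioo_subset_Icc_self (phases_subset_unitCell hy i hi)
  have hae : ∀ f : C.L2, (fun y => inner ℂ (hmem.toLp _ y) (f y))
      =ᵐ[volume.restrict C.phases] s.indicator fun y => f y * ψ y := by
    intro f
    filter_upwards [hmem.coeFn_toLp] with y hy
    rw [hy]
    by_cases h : y ∈ s <;> simp [h]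
  refine ⟨innerSL ℂ (hmem.toLp _), fun f => ⟨?_, ?_⟩⟩
  · have := (integrable_congr (hae f)).1 (L2.integrable_inner (𝕜 := ℂ) (hmem.toLp _) f)
    rw [integrable_indicator_iff hs, IntegrableOn, restrict_phases_restrict hsC] at this
    exact this
  · rw [innerSL_apply_apply, L2.inner_def, integral_congr_ae (hae f), integral_indicator hs,
      restrict_phases_restrict hsC]

/-- The coordinate projections of `VelGrad`. -/
noncomputable def component (a : Fin n ⊕ Fin n × Fin n) : C.VelGrad →L[ℂ] C.L2 :=
  PiLp.proj 2 (fun _ => C.L2) a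

theorem component_inl (u : C.VelGrad) (i : Fin n) : component (Sum.inl i) u = vel u i := rfl

theorem component_inr (u : C.VelGrad) (i j : Fin n) : component (Sum.inr (i, j)) u = grad u i j :=
  rfl

/-- For fixed `φ`, `i` and `j`, the difference of the two sides is a continuous linear functional of
`u`, so the condition is an intersection of closed kernels. -/
theorem isClosedSubspace_partsFormula {φ : (Fin n → ℝ) → ℂ} (hφ : ContDiff ℝ ∞ φ) :
    IsClosedSubspace {u : C.VelGrad | PartsFormula u φ} := by
  refine .setOf_forall fun i => .setOf_forall fun j => ?_
  obtain ⟨L, hL⟩ := exists_integral_mul_functional (C := C) measurableSet_phases subset_rfl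
    (continuous_partialD j hφ)
  obtain ⟨M, hM⟩ := exists_integral_mul_functional (C := C) measurableSet_phases subset_rfl
    hφ.continuous
  refine .of_iff (L ∘L component (Sum.inl i) + M ∘L component (Sum.inr (i, j))) fun u => ?_
  rw [← (hL _).2, ← (hM _).2, eq_neg_iff_add_eq_zero]
  rfl

theorem isClosedSubspace_noNormalTrace : IsClosedSubspace {u : C.VelGrad | NoNormalTrace u} := by
  refine .setOf_forall fun φ => .setOf_forall fun hφ => ?_
  choose L hL using fun i => exists_integral_mul_functional (C := C) C.isOpen₂.measurableSet
    Q₂_subset_phases (continuous_partialD i hφ)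
  obtain ⟨M, hM⟩ := exists_integral_mul_functional (C := C) C.isOpen₂.measurableSet
    Q₂_subset_phases hφ.continuous
  refine .of_iff (∑ i, L i ∘L component (Sum.inl i) + ∑ i, M ∘L component (Sum.inr (i, i)))
    fun u => ?_
  have h : ∀ y, (∑ i, vel u i y * partialD i φ y) + φ y * ∑ i, grad u i i y
      = (∑ i, vel u i y * partialD i φ y) + ∑ i, grad u i i y * φ y := by
    intro y; rw [mul_comm (φ y), Finset.sum_mul]
  simp only [h]
  rw [integral_add (integrable_finsetSum _ fun i _ => (hL i _).1)
    (integrable_finsetSum _ fun i _ => (hM _).1),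
    integral_finsetSum _ fun i _ => (hL i _).1, integral_finsetSum _ fun i _ => (hM _).1]
  simp only [← (hL _ _).2, ← (hM _).2]
  simp [component_inl, component_inr]

theorem isClosedSubspace_rigidOrthogonal :
    IsClosedSubspace {u : C.VelGrad | RigidOrthogonal u} := by
  refine .setOf_forall fun A => .setOf_forall fun b => .setOf_forall fun _ => ?_
  have hη : ∀ i, Continuous fun y : Fin n → ℝ => (((A *ᵥ y) i + b i : ℝ) : ℂ) := fun i =>
    Complex.continuous_ofReal.comp (((continuous_apply i).comp
      (continuous_const.matrix_mulVec continuous_id)).add continuous_const)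
  choose L hL using fun i => exists_integral_mul_functional (C := C) C.isOpen₂.measurableSet
    Q₂_subset_phases (hη i)
  choose M hM using fun i j => exists_integral_mul_functional (C := C) C.isOpen₂.measurableSet
    Q₂_subset_phases (ψ := fun _ => ((A i j : ℝ) : ℂ)) continuous_const
  refine .of_iff (∑ i, L i ∘L component (Sum.inl i)
    + ∑ i, ∑ j, M i j ∘L component (Sum.inr (i, j))) fun u => ?_
  rw [integral_add (integrable_finsetSum _ fun i _ => (hL i _).1)
    (integrable_finsetSum _ fun i _ => integrable_finsetSum _ fun j _ => (hM i j _).1),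
    integral_finsetSum _ fun i _ => (hL i _).1,
    integral_finsetSum _ fun i _ => integrable_finsetSum _ fun j _ => (hM i j _).1]
  have h : ∀ i, ∫ y in C.Q₂, ∑ j, grad u i j y * ((A i j : ℝ) : ℂ) = ∑ j, M i j (grad u i j) := by
    intro i
    rw [integral_finsetSum _ fun j _ => (hM i j _).1]
    simp only [(hM _ _ _).2]
  simp only [← (hL _ _).2, h]
  simp [component_inl, component_inr]

/-- The admissible fields form a closed subspace. -/
theorem isClosedSubspace_admissible : IsClosedSubspace C.admissible := by
  refine .setOf_and ?_ <| .setOf_and ?_ <| .setOf_and ?_ <| .setOf_and ?_ <|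
    .setOf_and isClosedSubspace_noNormalTrace isClosedSubspace_rigidOrthogonal
  · exact .setOf_forall fun φ => .setOf_forall fun hφ => .setOf_forall fun _ =>
      .setOf_forall fun _ => isClosedSubspace_partsFormula hφ
  · exact .setOf_forall fun φ => .setOf_forall fun hφ => .setOf_forall fun _ =>
      .setOf_forall fun _ => isClosedSubspace_partsFormula hφ
  · exact .setOf_forall fun φ => .setOf_forall fun hφ => .setOf_forall fun _ =>
      isClosedSubspace_partsFormula hφ
  · refine .of_iff (∑ i, component (Sum.inr (i, i))) fun u => ?_
    simp [DivFree, component_inr]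

/-! ### Korn and Poincaré inequalities through Fourier coefficients -/

/-- The Fourier coefficients of a function on the phases, extended by zero to the cell. -/
noncomputable def cellCoeff (k : Fin n → ℤ) : C.L2 →L[ℂ] ℂ :=
  (exists_integral_mul_functional (C := C) measurableSet_phases subset_rfl
    (contDiff_cellExp k).continuous).choose

theorem cellCoeff_apply (k : Fin n → ℤ) (f : C.L2) :
    cellCoeff k f = ∫ y in C.phases, f y * cellExp k y :=
  ((exists_integral_mul_functional (C := C) measurableSet_phases subset_rfl
    (contDiff_cellExp k).continuous).choose_spec f).2

theorem cellCoeff_zero (f : C.L2) : cellCoeff 0 f = ∫ y in C.phases, f y := by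
  simp [cellCoeff_apply, cellExp_zero]

theorem hasSum_sq_cellCoeff (f : C.L2) :
    HasSum (fun k => ‖cellCoeff k f‖ ^ 2) (‖f‖ ^ 2) := by
  have hsub : C.phases ⊆ halfOpenCube (Fin n) :=
    phases_subset_unitCell.trans (unitCell_subset_halfOpenCube n)
  have hmem : MemLp (C.phases.indicator f) 2 (volume.restrict (halfOpenCube (Fin n))) := by
    rw [memLp_indicator_iff_restrict measurableSet_phases,
      Measure.restrict_restrict_of_subset hsub]
    exact Lp.memLp f
  have key := hasSum_sq_integral_mul_cellExp hmem
  have h1 : ∀ k, ∫ y in halfOpenCube (Fin n), C.phases.indicator f y * cellExp k y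
      = cellCoeff k f := by
    intro k
    have : (fun y => C.phases.indicator f y * cellExp k y)
        = C.phases.indicator fun y => f y * cellExp k y := by
      funext y; by_cases h : y ∈ C.phases <;> simp [h]
    rw [this, integral_indicator measurableSet_phases,
      Measure.restrict_restrict_of_subset hsub, cellCoeff_apply]
  have h2 : ∫ y in halfOpenCube (Fin n), ‖C.phases.indicator f y‖ ^ 2 = ‖f‖ ^ 2 := by
    have : (fun y => ‖C.phases.indicator f y‖ ^ 2) = C.phases.indicator fun y => ‖f y‖ ^ 2 := by
      funext y; by_cases h : y ∈ C.phases <;> simp [h]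
    rw [this, integral_indicator measurableSet_phases, Measure.restrict_restrict_of_subset hsub]
    have h3 : inner ℂ f f = ((‖f‖ ^ 2 : ℝ) : ℂ) := by
      rw [inner_self_eq_norm_sq_to_K]; norm_cast
    rw [L2.inner_def] at h3
    have h4 : ∀ y, inner ℂ (f y) (f y) = ((‖f y‖ ^ 2 : ℝ) : ℂ) := fun y => by
      rw [inner_self_eq_norm_sq_to_K]; norm_cast
    simp only [h4] at h3
    rw [integral_complex_ofReal] at h3
    exact_mod_cast h3
  rw [h2] at key
  simpa only [h1] using key

/-- The exponentials are periodic and smooth, hence legitimate test functions in `IsCellPeriodic`,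
and no boundary or interface terms appear. The factor `I` stays with the velocity so that the
frequency is real, as `sum_norm_sq_mode_le` requires. -/
theorem cellCoeff_grad {u : C.VelGrad} (hu : IsCellPeriodic u) (k : Fin n → ℤ) (i j : Fin n) :
    cellCoeff k (grad u i j) = ((2 * Real.pi * k j : ℝ) : ℂ) * (Complex.I * cellCoeff k (vel u i))
    := by
  have h := hu (cellExp k) (contDiff_cellExp k) (cellExp_add_int k) i j
  have h1 : ∀ y, vel u i y * partialD j (cellExp k) y
      = -(2 * Real.pi * Complex.I * k j) * (vel u i y * cellExp k y) := by
    intro y; rw [partialD_cellExp]; ring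
  simp only [h1] at h
  rw [integral_const_mul, ← cellCoeff_apply, ← cellCoeff_apply] at h
  push_cast
  linear_combination h

/-- The symmetric gradient as an element of `L²`. -/
noncomputable def strainL2 (i j : Fin n) : C.VelGrad →L[ℂ] C.L2 :=
  (2⁻¹ : ℂ) • (component (Sum.inr (i, j)) + component (Sum.inr (j, i)))

theorem strainL2_apply (u : C.VelGrad) (i j : Fin n) :
    strainL2 i j u = (2⁻¹ : ℂ) • (grad u i j + grad u j i) := rfl

theorem coeFn_strainL2 (u : C.VelGrad) (i j : Fin n) :
    strainL2 i j u =ᵐ[volume.restrict C.phases] strain u i j := by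
  rw [strainL2_apply]
  filter_upwards [Lp.coeFn_smul (2⁻¹ : ℂ) (grad u i j + grad u j i),
    Lp.coeFn_add (grad u i j) (grad u j i)] with y h1 h2
  rw [h1, Pi.smul_apply, h2, Pi.add_apply, strain, smul_eq_mul]
  ring

/-- Korn's inequality for periodic fields. -/
theorem sum_norm_sq_grad_le {u : C.VelGrad} (hu : IsCellPeriodic u) :
    ∑ i, ∑ j, ‖grad u i j‖ ^ 2 ≤ 2 * ∑ i, ∑ j, ‖strainL2 i j u‖ ^ 2 := by
  have h1 := hasSum_sum (s := Finset.univ) fun i _ => hasSum_sum (s := Finset.univ)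
    fun j _ => hasSum_sq_cellCoeff (grad u i j)
  have h2 := (hasSum_sum (s := Finset.univ) fun i _ => hasSum_sum (s := Finset.univ)
    fun j _ => hasSum_sq_cellCoeff (strainL2 i j u)).mul_left 2
  refine hasSum_le (fun k => ?_) h1 h2
  have h := sum_norm_sq_mode_le (fun j => 2 * Real.pi * k j)
    fun i => Complex.I * cellCoeff k (vel u i)
  simp only [strainL2_apply, map_smul, map_add, cellCoeff_grad hu]
  simpa only [smul_eq_mul, div_eq_inv_mul] using h

/-- The Poincaré–Wirtinger inequality for periodic fields. -/
theorem norm_sq_vel_sub_le {u : C.VelGrad} (hu : IsCellPeriodic u) (i : Fin n) :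
    ‖vel u i‖ ^ 2 - ‖∫ y in C.phases, vel u i y‖ ^ 2 ≤ ∑ j, ‖grad u i j‖ ^ 2 := by
  rw [← cellCoeff_zero]
  have h1 := (hasSum_sq_cellCoeff (vel u i)).sub
    (hasSum_ite_eq (0 : Fin n → ℤ) (‖cellCoeff 0 (vel u i)‖ ^ 2))
  have h2 := hasSum_sum (s := Finset.univ) fun j _ => hasSum_sq_cellCoeff (grad u i j)
  refine hasSum_le (fun k => ?_) h1 h2
  split_ifs with hk
  · rw [hk, sub_self]; positivity
  -- Some component of a nonzero frequency is a nonzero integer, so `|2π k j| ≥ 1` and the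
  -- derivative in that single direction already dominates.
  · obtain ⟨j, hj⟩ := Function.ne_iff.1 hk
    rw [sub_zero]
    refine le_trans ?_ (Finset.single_le_sum (fun j _ => sq_nonneg ‖cellCoeff k (grad u i j)‖)
      (Finset.mem_univ j))
    rw [cellCoeff_grad hu, norm_mul, norm_mul, Complex.norm_I, one_mul, Complex.norm_real]
    have hkj : (1 : ℝ) ≤ |(k j : ℝ)| := by exact_mod_cast Int.one_le_abs hj
    have h3 : (1 : ℝ) ≤ ‖2 * Real.pi * k j‖ := by
      rw [norm_mul, Real.norm_eq_abs, Real.norm_eq_abs, abs_of_pos Real.two_pi_pos]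
      nlinarith [Real.pi_gt_three]
    gcongr
    exact le_mul_of_one_le_left (norm_nonneg _) h3

/-- A function without mean on the inclusion has a mean controlled by its variance. -/
theorem volume_mul_norm_sq_integral_le {f : C.L2} (hf : ∫ y in C.Q₂, f y = 0) :
    (volume C.Q₂).toReal * ‖∫ y in C.phases, f y‖ ^ 2
      ≤ ‖f‖ ^ 2 - ‖∫ y in C.phases, f y‖ ^ 2 := by
  set μ := volume.restrict C.phases with hμ
  set m := ∫ y in C.phases, f y with hm
  set q := (volume C.Q₂).toReal with hq
  have hq0 : 0 < q := ENNReal.toReal_pos C.volume_pos₂.ne' ((measure_mono Q₂_subset_phases).trans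
    volume_phases_le_one |>.trans_lt ENNReal.one_lt_top).ne
  have hμQ : μ.real C.Q₂ = q := by
    rw [Measure.real, hμ, Measure.restrict_apply C.isOpen₂.measurableSet,
      Set.inter_eq_left.2 Q₂_subset_phases]
  have hμu : μ.real Set.univ ≤ 1 := by
    rw [Measure.real, hμ, Measure.restrict_apply_univ]
    exact ENNReal.toReal_le_of_le_ofReal zero_le_one (by simpa using volume_phases_le_one)
  set h : C.L2 := indicatorConstLp 2 MeasurableSet.univ (measure_ne_top μ _) (1 : ℂ) with hh
  set h₂ : C.L2 := indicatorConstLp 2 C.isOpen₂.measurableSet (measure_ne_top μ _) (1 : ℂ) with hh₂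
  have i1 : inner ℂ h f = m := by
    rw [hh, L2.inner_indicatorConstLp_one, Measure.restrict_univ]
  have i2 : inner ℂ h₂ f = 0 := by
    rw [hh₂, L2.inner_indicatorConstLp_one, restrict_phases_restrict Q₂_subset_phases, hf]
  have i3 : inner ℂ h₂ h = (q : ℂ) := by
    rw [hh₂, hh, L2.inner_indicatorConstLp_indicatorConstLp, Set.inter_univ, hμQ]
    simp
  have n1 : ‖h‖ ^ 2 ≤ 1 := by
    rw [hh, norm_indicatorConstLp (by simp) (by simp)]
    simp only [norm_one, one_mul, ENNReal.toReal_ofNat, ← Real.sqrt_eq_rpow]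
    rw [Real.sq_sqrt measureReal_nonneg]
    exact hμu
  have n2 : ‖h₂‖ ^ 2 = q := by
    rw [hh₂, norm_indicatorConstLp (by simp) (by simp)]
    simp only [norm_one, one_mul, ENNReal.toReal_ofNat, ← Real.sqrt_eq_rpow]
    rw [Real.sq_sqrt measureReal_nonneg, hμQ]
  -- Expanding the square gives `‖f‖² - 2‖m‖² + ‖m‖²‖h‖²`, and `‖h‖ ≤ 1` because the phases have
  -- measure at most one.
  have e1 : ‖f - m • h‖ ^ 2 ≤ ‖f‖ ^ 2 - ‖m‖ ^ 2 := by
    have e : inner ℂ f (m • h) = ((‖m‖ ^ 2 : ℝ) : ℂ) := by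
      rw [inner_smul_right, ← inner_conj_symm, i1, Complex.mul_conj, Complex.normSq_eq_norm_sq]
    rw [norm_sub_sq (𝕜 := ℂ), e, norm_smul, mul_pow]
    simp only [RCLike.re_to_complex, Complex.ofReal_re]
    nlinarith [sq_nonneg ‖m‖]
  -- Since `f` has zero integral over the inclusion, pairing `f - m • h` with the indicator of the
  -- inclusion leaves `-m q`; Cauchy–Schwarz then bounds `m`.
  have e2 : ‖m‖ * q ≤ ‖h₂‖ * ‖f - m • h‖ := by
    have := norm_inner_le_norm (𝕜 := ℂ) h₂ (f - m • h)
    rw [inner_sub_right, inner_smul_right, i2, i3, zero_sub, norm_neg, norm_mul, Complex.norm_real,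
      Real.norm_of_nonneg hq0.le] at this
    exact this
  have e3 : (‖m‖ * q) ^ 2 ≤ q * ‖f - m • h‖ ^ 2 := by
    rw [← n2, ← mul_pow, n2]
    gcongr
  have e4 : q * ‖m‖ ^ 2 ≤ ‖f - m • h‖ ^ 2 := by
    refine le_of_mul_le_mul_left ?_ hq0
    linarith
  exact e4.trans e1

/-- Translations are rigid displacements: take `A = 0` and `b = eᵢ`, for which the gradient term
disappears. -/
theorem integral_vel_eq_zero {u : C.VelGrad} (hu : RigidOrthogonal u) (i : Fin n) :
    ∫ y in C.Q₂, vel u i y = 0 := by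
  have h := hu 0 (Pi.single i 1) (by simp)
  have h1 : ∀ y : Fin n → ℝ, (∑ l, vel u l y *
      ((((0 : Matrix (Fin n) (Fin n) ℝ) *ᵥ y) l + Pi.single (M := fun _ => ℝ) i 1 l : ℝ) : ℂ))
      = vel u i y := by
    intro y
    rw [Finset.sum_eq_single i]
    · simp
    · intro l _ hl; simp [hl]
    · simp
  simp only [h1] at h
  simpa using h

/-- The symmetric gradient controls the `H¹` norm of the admissible fields. -/
theorem exists_coercive : ∃ c : ℝ, 0 < c ∧ ∀ u ∈ C.admissible,
    c * ‖u‖ ^ 2 ≤ ∑ i, ∑ j, ‖strainL2 i j u‖ ^ 2 := by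
  set q := (volume C.Q₂).toReal with hq
  have hq0 : 0 < q := ENNReal.toReal_pos C.volume_pos₂.ne' ((measure_mono Q₂_subset_phases).trans
    volume_phases_le_one |>.trans_lt ENNReal.one_lt_top).ne
  -- The velocity costs `1 + q⁻¹` times the gradient norm squared (Poincaré plus the mean), the
  -- gradient itself adds 1, and Korn contributes the factor 2.
  refine ⟨(2 * (2 + q⁻¹))⁻¹, by positivity, fun u hu => ?_⟩
  obtain ⟨-, -, hper, -, -, hrig⟩ := hu
  have hn : ‖u‖ ^ 2 = ∑ i, ‖vel u i‖ ^ 2 + ∑ i, ∑ j, ‖grad u i j‖ ^ 2 := by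
    rw [PiLp.norm_sq_eq_of_L2, Fintype.sum_sum_type, Fintype.sum_prod_type]
    rfl
  have hv : ∀ i, ‖vel u i‖ ^ 2 ≤ (1 + q⁻¹) * ∑ j, ‖grad u i j‖ ^ 2 := by
    intro i
    have h1 := norm_sq_vel_sub_le hper i
    have h2 := volume_mul_norm_sq_integral_le (integral_vel_eq_zero hrig i)
    rw [← hq] at h2
    have h3 : ‖∫ y in C.phases, vel u i y‖ ^ 2 ≤ q⁻¹ * ∑ j, ‖grad u i j‖ ^ 2 := by
      rw [inv_mul_eq_div, le_div_iff₀ hq0]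
      linarith
    linarith
  have hk := sum_norm_sq_grad_le hper
  rw [inv_mul_le_iff₀ (by positivity), hn]
  calc ∑ i, ‖vel u i‖ ^ 2 + ∑ i, ∑ j, ‖grad u i j‖ ^ 2
      ≤ ∑ i, (1 + q⁻¹) * ∑ j, ‖grad u i j‖ ^ 2 + ∑ i, ∑ j, ‖grad u i j‖ ^ 2 := by
        gcongr with i; exact hv i
    _ = (2 + q⁻¹) * ∑ i, ∑ j, ‖grad u i j‖ ^ 2 := by rw [← Finset.mul_sum]; ring
    _ ≤ (2 + q⁻¹) * (2 * ∑ i, ∑ j, ‖strainL2 i j u‖ ^ 2) := by gcongr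
    _ = _ := by ring

end PeriodicCell

/-! ### The viscous form and well-posedness of the cell problem -/

namespace PeriodicCell

variable {n : ℕ} {C : PeriodicCell n}

/-- The symmetric gradient on a part `s` of the phases. -/
noncomputable def strainOn (s : Set (Fin n → ℝ)) : C.VelGrad →L[ℂ]
    PiLp 2 fun _ : Fin n × Fin n => Lp ℂ 2 ((volume.restrict C.phases).restrict s) :=
  (PiLp.continuousLinearEquiv 2 ℂ _).symm.toContinuousLinearMap ∘L
    ContinuousLinearMap.pi fun p =>
      LpToLpRestrictCLM (Fin n → ℝ) ℂ ℂ (volume.restrict C.phases) 2 s ∘L strainL2 p.1 p.2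

theorem strainOn_apply (s : Set (Fin n → ℝ)) (u : C.VelGrad) (p : Fin n × Fin n) :
    strainOn s u p = LpToLpRestrictCLM (Fin n → ℝ) ℂ ℂ (volume.restrict C.phases) 2 s
      (strainL2 p.1 p.2 u) := rfl

theorem integrable_strain_mul_conj (u v : C.VelGrad) (i j : Fin n) :
    IntegrableOn (fun y => strain u i j y * conj (strain v i j y)) C.phases := by
  refine (integrable_congr ?_).1 (L2.integrable_inner (𝕜 := ℂ) (strainL2 i j v) (strainL2 i j u))
  filter_upwards [coeFn_strainL2 u i j, coeFn_strainL2 v i j] with y hu hv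
  rw [hu, hv, RCLike.inner_apply]

theorem inner_strainL2 (u v : C.VelGrad) (i j : Fin n) :
    inner ℂ (strainL2 i j v) (strainL2 i j u)
      = ∫ y in C.phases, strain u i j y * conj (strain v i j y) := by
  rw [L2.inner_def]
  refine integral_congr_ae ?_
  filter_upwards [coeFn_strainL2 u i j, coeFn_strainL2 v i j] with y hu hv
  rw [hu, hv, RCLike.inner_apply]

theorem integrable_sum_strain (u v : C.VelGrad) :
    IntegrableOn (fun y => ∑ i, ∑ j, strain u i j y * conj (strain v i j y)) C.phases :=
  integrable_finsetSum _ fun i _ => integrable_finsetSum _ fun j _ =>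
    integrable_strain_mul_conj u v i j

theorem inner_strainOn {s : Set (Fin n → ℝ)} (hs : s ⊆ C.phases) (u v : C.VelGrad) :
    inner ℂ (strainOn s v) (strainOn s u)
      = ∫ y in s, ∑ i, ∑ j, strain u i j y * conj (strain v i j y) := by
  have hint := fun i j => (integrable_strain_mul_conj u v i j).mono_set hs
  rw [integral_finsetSum _ fun i _ => integrable_finsetSum _ fun j _ => hint i j,
    PiLp.inner_apply, Fintype.sum_prod_type]
  refine Finset.sum_congr rfl fun i _ => ?_
  rw [integral_finsetSum _ fun j _ => hint i j]
  refine Finset.sum_congr rfl fun j _ => ?_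
  rw [L2.inner_def, ← restrict_phases_restrict hs]
  refine integral_congr_ae ?_
  filter_upwards [LpToLpRestrictCLM_coeFn ℂ s (strainL2 i j u),
    LpToLpRestrictCLM_coeFn ℂ s (strainL2 i j v),
    ae_restrict_of_ae (s := s) (coeFn_strainL2 u i j),
    ae_restrict_of_ae (s := s) (coeFn_strainL2 v i j)] with y h1 h2 h3 h4
  rw [strainOn_apply, strainOn_apply, h1, h2, h3, h4, RCLike.inner_apply]

/-- The phases are disjoint, so the strain energy is additive over them. This turns
`exists_coercive` into the lower bound on `S₁ ⊕ S₂` needed for Lax–Milgram. -/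
theorem norm_sq_strainOn_add (u : C.VelGrad) :
    ‖strainOn C.Q₁ u‖ ^ 2 + ‖strainOn C.Q₂ u‖ ^ 2 = ∑ i, ∑ j, ‖strainL2 i j u‖ ^ 2 := by
  have h : inner ℂ (strainOn C.Q₁ u) (strainOn C.Q₁ u) + inner ℂ (strainOn C.Q₂ u)
      (strainOn C.Q₂ u) = ∑ i, ∑ j, inner ℂ (strainL2 i j u) (strainL2 i j u) := by
    rw [inner_strainOn Q₁_subset_phases, inner_strainOn Q₂_subset_phases,
      ← setIntegral_union C.disjoint C.isOpen₂.measurableSet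
        ((integrable_sum_strain u u).mono_set Q₁_subset_phases)
        ((integrable_sum_strain u u).mono_set Q₂_subset_phases)]
    change ∫ y in C.phases, _ = _
    rw [integral_finsetSum _ fun i _ => integrable_finsetSum _ fun j _ =>
      integrable_strain_mul_conj u u i j]
    refine Finset.sum_congr rfl fun i _ => ?_
    rw [integral_finsetSum _ fun j _ => integrable_strain_mul_conj u u i j]
    simp only [inner_strainL2]
  simp only [inner_self_eq_norm_sq_to_K] at h
  exact_mod_cast h

/-- An integral weighted with the viscosity splits into the contributions of the two phases. -/
theorem integral_viscosity_mul (μ₁ : ℝ) (z : ℂ) {g : (Fin n → ℝ) → ℂ}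
    (hg : IntegrableOn g C.phases) :
    ∫ y in C.phases, 2 * C.viscosity μ₁ z y * g y
      = 2 * μ₁ * ((∫ y in C.Q₁, g y) + z * ∫ y in C.Q₂, g y) := by
  have h1 : Set.EqOn (fun y => 2 * C.viscosity μ₁ z y * g y) (fun y => 2 * μ₁ * g y) C.Q₁ := by
    intro y hy
    have : y ∉ C.Q₂ := Set.disjoint_left.1 C.disjoint hy
    simp [viscosity, hy, this]
  have h2 : Set.EqOn (fun y => 2 * C.viscosity μ₁ z y * g y)
      (fun y => 2 * μ₁ * z * g y) C.Q₂ := by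
    intro y hy
    have : y ∉ C.Q₁ := Set.disjoint_right.1 C.disjoint hy
    simp only [viscosity, Set.indicator_of_notMem this, Set.indicator_of_mem hy, Pi.one_apply]
    ring
  have m1 := C.isOpen₁.measurableSet
  have m2 := C.isOpen₂.measurableSet
  rw [phases, setIntegral_union C.disjoint m2
    ((integrableOn_congr_fun h1 m1).2 ((hg.mono_set Q₁_subset_phases).const_mul _))
    ((integrableOn_congr_fun h2 m2).2 ((hg.mono_set Q₂_subset_phases).const_mul _)),
    setIntegral_congr_fun m1 h1, setIntegral_congr_fun m2 h2, integral_const_mul,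
    integral_const_mul]
  ring

theorem viscousForm_eq (μ₁ : ℝ) (z : ℂ) (u v : C.VelGrad) :
    C.viscousForm μ₁ z u v = 2 * μ₁ * (inner ℂ (strainOn C.Q₁ v) (strainOn C.Q₁ u)
      + z * inner ℂ (strainOn C.Q₂ v) (strainOn C.Q₂ u)) := by
  rw [viscousForm, integral_viscosity_mul μ₁ z (integrable_sum_strain u v),
    inner_strainOn Q₁_subset_phases, inner_strainOn Q₂_subset_phases]

/-- The field representing the unit force `eₖ`. -/
theorem exists_force (k : Fin n) : ∃ f : C.VelGrad, ∀ v : C.VelGrad,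
    inner ℂ v f = ∫ y in C.phases, conj (vel v k y) := by
  refine ⟨(InnerProductSpace.toDual ℂ C.VelGrad).symm (cellCoeff 0 ∘L component (Sum.inl k)),
    fun v => ?_⟩
  rw [← inner_conj_symm, InnerProductSpace.toDual_symm_apply, integral_conj,
    ContinuousLinearMap.comp_apply, cellCoeff_zero]
  rfl

/-- Lax–Milgram is applied in the closed subspace of admissible fields. The data are the force
vector divided by `2μ₁` and projected orthogonally onto that subspace, which does not change its
pairing with admissible test fields. -/
theorem existsUnique_isCellSolution {μ₁ : ℝ} (hμ₁ : 0 < μ₁) {z : ℂ} (hz : z ∈ Complex.slitPlane)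
    (k : Fin n) : ∃! u : C.VelGrad, C.IsCellSolution μ₁ z k u := by
  obtain ⟨V, hVc, hV⟩ := isClosedSubspace_admissible (C := C)
  obtain ⟨c, hc, hcoer⟩ := exists_coercive (C := C)
  obtain ⟨f, hf⟩ := exists_force (C := C) k
  have : CompleteSpace V := hVc.completeSpace_coe
  have hmem : ∀ u, u ∈ V ↔ u ∈ C.admissible := fun u => by rw [← hV]; rfl
  have h2μ : (2 * μ₁ : ℂ) ≠ 0 := by exact_mod_cast (by positivity : 2 * μ₁ ≠ 0)
  obtain ⟨u, hu, huniq⟩ := existsUnique_inner_add_mul_inner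
    (strainOn C.Q₁ ∘L V.subtypeL) (strainOn C.Q₂ ∘L V.subtypeL) hc
    (fun u => by
      have := hcoer u ((hmem u).1 u.2)
      rw [← norm_sq_strainOn_add] at this
      exact this) hz (V.orthogonalProjectionOnto ((2 * μ₁ : ℂ)⁻¹ • f))
  have hiff : ∀ u : V, (∀ v : V, inner ℂ ((strainOn C.Q₁ ∘L V.subtypeL) v)
      ((strainOn C.Q₁ ∘L V.subtypeL) u) + z * inner ℂ ((strainOn C.Q₂ ∘L V.subtypeL) v)
      ((strainOn C.Q₂ ∘L V.subtypeL) u) = inner ℂ v (V.orthogonalProjectionOnto ((2 * μ₁ : ℂ)⁻¹ • f)))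
      ↔ C.IsCellSolution μ₁ z k u := by
    intro u
    have hpt : ∀ v : V, (inner ℂ ((strainOn C.Q₁ ∘L V.subtypeL) v)
      ((strainOn C.Q₁ ∘L V.subtypeL) u) + z * inner ℂ ((strainOn C.Q₂ ∘L V.subtypeL) v)
      ((strainOn C.Q₂ ∘L V.subtypeL) u) = inner ℂ v (V.orthogonalProjectionOnto ((2 * μ₁ : ℂ)⁻¹ • f)))
      ↔ C.viscousForm μ₁ z u v = ∫ y in C.phases, conj (vel (v : C.VelGrad) k y) := by
      intro v
      rw [Submodule.inner_orthogonalProjectionOnto_eq_of_mem_left, inner_smul_right, hf,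
        viscousForm_eq, eq_inv_mul_iff_mul_eq₀ h2μ]
      rfl
    simp only [hpt]
    exact ⟨fun h => ⟨(hmem u).1 u.2, fun v hv => h ⟨v, (hmem v).2 hv⟩⟩,
      fun h v => h.2 v ((hmem v).1 v.2)⟩
  exact ⟨u, (hiff u).1 hu, fun u' hu' =>
    congrArg Subtype.val (huniq ⟨u', (hmem u').2 hu'.1⟩ ((hiff ⟨u', (hmem u').2 hu'.1⟩).2 hu'))⟩

theorem isCellSolution_cellSolution {μ₁ : ℝ} (hμ₁ : 0 < μ₁) {z : ℂ}
    (hz : z ∈ Complex.slitPlane) (k : Fin n) :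
    C.IsCellSolution μ₁ z k (C.cellSolution μ₁ z k) := by
  have h := (existsUnique_isCellSolution (C := C) hμ₁ hz k).exists
  rw [cellSolution, dif_pos h]
  exact h.choose_spec

/-! ### The self-permeability as a combination of Gram matrices -/

/-- The equation for `uⁱ` tested with `uʲ` yields the conjugate of `Kᵢⱼ`. Conjugating back swaps the
arguments of the inner products and replaces `z` by `z̄`. -/
theorem selfPermeability_apply_eq {μ₁ : ℝ} (hμ₁ : 0 < μ₁) {z : ℂ} (hz : z ∈ Complex.slitPlane)
    (i j : Fin n) :
    C.selfPermeability μ₁ z i j = 2 * μ₁ *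
      (inner ℂ (strainOn C.Q₁ (C.cellSolution μ₁ z i)) (strainOn C.Q₁ (C.cellSolution μ₁ z j))
      + conj z * inner ℂ (strainOn C.Q₂ (C.cellSolution μ₁ z i))
        (strainOn C.Q₂ (C.cellSolution μ₁ z j))) := by
  have h := (isCellSolution_cellSolution (C := C) hμ₁ hz i).2 _
    (isCellSolution_cellSolution (C := C) hμ₁ hz j).1
  rw [viscousForm_eq, integral_conj] at h
  have h' := congrArg conj h
  rw [Complex.conj_conj] at h'
  rw [selfPermeability, Matrix.of_apply, ← h']
  simp only [map_mul, map_add, inner_conj_symm, Complex.conj_ofReal, map_ofNat]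

theorem selfPermeability_eq_gram {μ₁ : ℝ} (hμ₁ : 0 < μ₁) {z : ℂ} (hz : z ∈ Complex.slitPlane) :
    C.selfPermeability μ₁ z = (2 * μ₁ : ℂ) •
      (Matrix.gram ℂ (fun i => strainOn C.Q₁ (C.cellSolution μ₁ z i))
      + conj z • Matrix.gram ℂ (fun i => strainOn C.Q₂ (C.cellSolution μ₁ z i))) := by
  ext i j
  rw [selfPermeability_apply_eq hμ₁ hz]
  simp [Matrix.gram_apply]

end PeriodicCell

theorem mainTheorem7 (n : ℕ) (hn : n = 2 ∨ n = 3) (C : PeriodicCell n) (μ₁ : ℝ) (hμ₁ : 0 < μ₁) :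
    -- the cell problems are well posed off the negative real half-line, so `K(z)` makes sense
    (∀ z ∈ Complex.slitPlane, ∀ k : Fin n, ∃! u : C.VelGrad, C.IsCellSolution μ₁ z k u) ∧
    -- the quadratic form of the self-permeability
    (∀ z ∈ Complex.slitPlane, ∀ i j : Fin n,
      C.selfPermeability μ₁ z i j =
        ∫ y in C.phases, 2 * C.viscosity μ₁ (conj z) y *
          ∑ k, ∑ l, conj (PeriodicCell.strain (C.cellSolution μ₁ z i) k l y) *
            PeriodicCell.strain (C.cellSolution μ₁ z j) k l y) ∧
    -- the two inequalities, in the sense of Hermitian positive semidefinite matrices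
    (∀ z : ℂ, z.im ≠ 0 →
      (z - conj z)⁻¹ • (C.selfPermeability μ₁ z - (C.selfPermeability μ₁ z)ᴴ) ≤ 0) ∧
    (∀ x : ℝ, 0 < x → 0 ≤ C.selfPermeability μ₁ (x : ℂ)) := by
  have h2μ : (0 : ℂ) ≤ 2 * μ₁ := by exact_mod_cast (by positivity : (0 : ℝ) ≤ 2 * μ₁)
  refine ⟨fun z hz k => PeriodicCell.existsUnique_isCellSolution hμ₁ hz k, fun z hz i j => ?_,
    fun z hz => ?_, fun x hx => ?_⟩
  · simp only [mul_comm (conj (PeriodicCell.strain _ _ _ _))]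
    rw [PeriodicCell.selfPermeability_apply_eq hμ₁ hz]
    exact (PeriodicCell.viscousForm_eq μ₁ (conj z) _ _).symm
  · have hne : z - conj z ≠ 0 := by
      rw [Complex.sub_conj]
      simpa using hz
    rw [PeriodicCell.selfPermeability_eq_gram hμ₁ (Or.inr hz)]
    set A := Matrix.gram ℂ (fun i => PeriodicCell.strainOn C.Q₁ (C.cellSolution μ₁ z i))
    set B := Matrix.gram ℂ (fun i => PeriodicCell.strainOn C.Q₂ (C.cellSolution μ₁ z i)) with hB
    have hA : Aᴴ = A := Matrix.isHermitian_gram ℂ _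
    have hB' : Bᴴ = B := Matrix.isHermitian_gram ℂ _
    -- Both Gram matrices are Hermitian, so `A` cancels in `K - K*` and `B` is left with the factor
    -- `2μ₁(z̄ - z)`.
    have h : (z - conj z)⁻¹ • ((2 * μ₁ : ℂ) • (A + conj z • B)
        - ((2 * μ₁ : ℂ) • (A + conj z • B))ᴴ) = -((2 * μ₁ : ℂ) • B) := by
      simp only [Matrix.conjTranspose_smul, Matrix.conjTranspose_add, hA, hB', star_mul',
        RCLike.star_def, Complex.conj_conj, Complex.conj_ofReal, map_ofNat]
      ext i j
      simp only [Matrix.smul_apply, Matrix.sub_apply, Matrix.add_apply, Matrix.neg_apply,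
        smul_eq_mul]
      field_simp
      ring
    rw [h, Left.neg_nonpos_iff, Matrix.nonneg_iff_posSemidef]
    exact (Matrix.posSemidef_gram ℂ _).smul h2μ
  · rw [PeriodicCell.selfPermeability_eq_gram hμ₁ (Or.inl (by simpa using hx)),
      Matrix.nonneg_iff_posSemidef, Complex.conj_ofReal]
    exact ((Matrix.posSemidef_gram ℂ _).add ((Matrix.posSemidef_gram ℂ _).smul
      (by exact_mod_cast hx.le))).smul h2μ
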